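/- **Model.** Let $\mathcal G=(\mathcal V,\mathcal E)$ be a finite directed graph with link capacities $C_{ij}\ge 0$, a destination $d\in\mathcal V$, and lifetimes $\mathcal L=\{1,\dots,L\}$, $L\ge1$. In slot $t=0,1,2,\dots$ an amount $a_i^{(l)}(t)\ge 0$ of lifetime-$l$ packets arrives at node $i$; the arrival vectors are bounded and i.i.d. over time, nothing arrives at $d$, and $\lambda_i^{(l)}=\mathbb E\,a_i^{(l)}(t)$. A *control policy* chooses in each slot, before that slot's arrivals, real flow variables $x(t)=\{x_{ij}^{(l)}(t)\}_{(i,j)\in\mathcal E,\,l\in\mathcal L}$ as a measurable function of the past arrivals and of private randomness independent of the arrivals. Write $x_{ij}=\sum_{l\in\mathcal L}x_{ij}^{(l)}$, $x_{i\to}^{(l)}=\sum_{j}x_{ij}^{(l)}$, $x_{\to i}^{(l)}=\sum_j x_{ji}^{(l)}$ (sums over links of $\mathcal E$), a superscript $(\ge l)$ for summation over all lifetimes $\ell$ with $l\le \ell\le L$, $x_{\to d}=x_{\to d}^{(\ge 1)}$, and $\overline{z}=\lim_{T\to\infty}\frac1T\sum_{t<T}z(t)$. For either problem, the flow variables must be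 nonnegative (almost surely) with finite means, the limits $\overline{\mathbb E\,x_{ij}^{(l)}}$ forming the *flow assignment* of the policy must exist, and the reliability constraint $\overline{\mathbb E\,x_{\to d}}\ge\gamma\|\lambda\|_1$ must hold. In addition (pathwise constraints holding almost surely): * a policy is *admissible for $\mathscr P_1$* if $\overline{\mathbb E\,x_{ij}}\le C_{ij}$ for all $(i,j)\in\mathcal E$, and $x_{i\to}^{(l)}(t)\le Q_i^{(l)}(t)$ for all $i\in\mathcal V$, $l\in\mathcal L$, $t\ge 0$, where the queues are empty at $t=0$, $Q_i^{(l)}(t+1)=Q_i^{(l+1)}(t)-x_{i\to}^{(l+1)}(t)+x_{\to i}^{(l+1)}(t)+a_i^{(l)}(t)$ for $i\ne d$, $l\in\mathcal L$ (terms of lifetime $L+1$ being zero), and $Q_i^{(0)}(t)=0$, $Q_d^{(l)}(t)=0$; * a policy is *admissible for $\mathscr P_2$* if $x_{ij}(t)\le C_{ij}$ for all $(i,j)\in\mathcal E$, $t\ge 0$; $\overline{\mathbb E\,x_{i\to}^{(\ge l)}}\le\overline{\mathbb E\,x_{\to i}^{(\ge l+1)}}+\lambda_i^{(\ge l)}$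 for all $i\in\mathcal V$, $l\in\mathcal L$; and the destination sends nothing, $x_{dk}^{(l)}(t)=0$ for all $(d,k)\in\mathcal E$, $l\in\mathcal L$, $t\ge 0$. For $n=1,2$, given an arrival process with mean $\lambda$ and $\gamma\in\mathbb R$, let $\mathcal A_n$ be the set of policies admissible for $\mathscr P_n$ and $\Gamma_n$ the set of their flow assignments; let $\Lambda_n$ be the set of pairs $(\lambda,\gamma)$ for which $\mathcal A_n\neq\emptyset$ for some arrival process with mean $\lambda$. **Proposition.** For every such network, $\Lambda_1=\Lambda_2$, and for every $(\lambda,\gamma)\in\Lambda_1=\Lambda_2$ and every arrival process with mean $\lambda$, $\Gamma_1=\Gamma_2$. This holds even though in general neither admissible policy space contains the other: there are a network, an arrival process with mean $\lambda$, and $\gamma\in(0,1]$ with $(\lambda,\gamma)\in\Lambda_1=\Lambda_2$ such that $\mathcal A_1\not\subseteq\mathcal A_2$ and $\mathcal A_2\not\subseteq\mathcal A_1$. -/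

import Mathlib

open MeasureTheory Filter Topology

/-- The lifetimes `1, …, L` of an effective packet. -/
abbrev Lifetime (L : ℕ) : Type := ↥(Finset.Icc 1 L)

/-- Value of a lifetime-indexed quantity at an arbitrary natural number; it vanishes at
lifetimes outside `1, …, L` (no outdated packets, no packets living longer than `L`). -/
def atLife {L : ℕ} (f : Lifetime L → ℝ) (l : ℕ) : ℝ :=
  if h : l ∈ Finset.Icc 1 L then f ⟨l, h⟩ else 0

/-- Long-term average `lim_{T → ∞} (1/T) ∑_{t < T} z t`. It is only used for sequences whose
averages are required to converge, see `HasTimeAvg`. -/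
noncomputable def timeAvg (z : ℕ → ℝ) : ℝ :=
  limUnder atTop (fun T : ℕ => (∑ t ∈ Finset.range T, z t) / (T : ℝ))

/-- The limit defining the long-term average of `z` exists (and is finite). -/
def HasTimeAvg (z : ℕ → ℝ) : Prop :=
  ∃ c : ℝ, Tendsto (fun T : ℕ => (∑ t ∈ Finset.range T, z t) / (T : ℝ)) atTop (𝓝 c)

/-- A packet routing network: a finite directed graph with link capacities, a destination node
and a maximal packet lifetime. -/
structure Network (V : Type*) where
  links : Finset (V × V)
  dest : V
  maxLife : ℕ
  maxLife_pos : 1 ≤ maxLife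
  capacity : ↥links → ℝ
  capacity_nonneg : ∀ e, 0 ≤ capacity e

namespace Network

variable {V : Type*} [Fintype V] [DecidableEq V]

/-- Arrivals in one slot (or arrival rates), indexed by node and lifetime. -/
abbrev Arrival (N : Network V) : Type _ := V → Lifetime N.maxLife → ℝ

/-- Flow variables in one slot (or flow assignments), indexed by link and lifetime. -/
abbrev Flow (N : Network V) : Type _ := ↥N.links → Lifetime N.maxLife → ℝ

/-- Total flow of lifetime `l` entering node `i`. -/
def inflow (N : Network V) (x : N.Flow) (i : V) (l : ℕ) : ℝ :=
  ∑ e : ↥N.links, if e.1.2 = i then atLife (x e) l else 0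

/-- Total flow of lifetime `l` leaving node `i`. -/
def outflow (N : Network V) (x : N.Flow) (i : V) (l : ℕ) : ℝ :=
  ∑ e : ↥N.links, if e.1.1 = i then atLife (x e) l else 0

/-- Total flow of lifetime at least `l` entering node `i`. -/
def inflowGe (N : Network V) (x : N.Flow) (i : V) (l : ℕ) : ℝ :=
  ∑ k ∈ Finset.Icc l N.maxLife, N.inflow x i k

/-- Total flow of lifetime at least `l` leaving node `i`. -/
def outflowGe (N : Network V) (x : N.Flow) (i : V) (l : ℕ) : ℝ :=
  ∑ k ∈ Finset.Icc l N.maxLife, N.outflow x i k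

/-- Queue backlogs `Q_i^{(l)}(t)` produced by the arrivals `a` and the decisions `x`. Queues are
empty at time `0`; outdated packets are dropped; the destination consumes its packets at once. -/
def queue (N : Network V) (a : ℕ → N.Arrival) (x : ℕ → N.Flow) : ℕ → V → ℕ → ℝ
  | 0, _, _ => 0
  | t + 1, i, l =>
    if i = N.dest ∨ l ∉ Finset.Icc 1 N.maxLife then 0
    else N.queue a x t i (l + 1) - N.outflow (x t) i (l + 1) + N.inflow (x t) i (l + 1)
      + atLife (a t i) l

/-- The distribution of the arrivals in one slot: nonnegative, bounded, nothing arriving at the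
destination. Arrivals of different nodes and lifetimes may be dependent. -/
structure ArrivalLaw (N : Network V) where
  law : Measure N.Arrival
  isProb : IsProbabilityMeasure law
  bounded : ∃ A : ℝ, ∀ᵐ a ∂law, ∀ i l, 0 ≤ a i l ∧ a i l ≤ A
  dest_zero : ∀ᵐ a ∂law, ∀ l, a N.dest l = 0

/-- The arrival vector: mean arrivals per slot. -/
noncomputable def ArrivalLaw.rate {N : Network V} (A : N.ArrivalLaw) : N.Arrival :=
  fun i l => ∫ a, a i l ∂A.law

/-- Sum of the absolute values of the entries of an arrival vector. -/
def norm1 (N : Network V) (lam : N.Arrival) : ℝ := ∑ i, ∑ l, |lam i l|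

/-- A (randomized, history dependent, causal) control policy: the decision in slot `t` is a
measurable function of the arrivals in the slots before `t` and of a private random element
independent of all arrivals. Arrivals of slot `t` come in after the decision of slot `t`. -/
structure Policy (N : Network V) where
  Seed : Type
  seedSpace : MeasurableSpace Seed
  seedLaw : Measure Seed
  isProb : IsProbabilityMeasure seedLaw
  decision : (t : ℕ) → (Fin t → N.Arrival) → Seed → N.Flow
  measurable_decision : ∀ t, Measurable (Function.uncurry (decision t))

attribute [instance] ArrivalLaw.isProb Policy.seedSpace Policy.isProb

/-- Sample points: an arrival sequence and a value of the private random element. -/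
abbrev Policy.Sample {N : Network V} (p : N.Policy) : Type _ := (ℕ → N.Arrival) × p.Seed

/-- The arrivals are i.i.d. over time with law `A`, and independent of the private randomness. -/
noncomputable def Policy.prob {N : Network V} (p : N.Policy) (A : N.ArrivalLaw) :
    Measure p.Sample :=
  (Measure.infinitePi (fun _ : ℕ => A.law)).prod p.seedLaw

/-- The flow variables `x(t)` decided by the policy. -/
def Policy.flow {N : Network V} (p : N.Policy) (t : ℕ) (ω : p.Sample) : N.Flow :=
  p.decision t (fun s => ω.1 s) ω.2

/-- The queue backlogs under the policy. -/
def Policy.backlog {N : Network V} (p : N.Policy) (t : ℕ) (ω : p.Sample) : V → ℕ → ℝ :=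
  N.queue ω.1 (fun s => p.flow s ω) t

/-- The flow assignment of a policy: long-term averages of the expected flow variables. -/
noncomputable def Policy.flowAssignment {N : Network V} (p : N.Policy) (A : N.ArrivalLaw) :
    N.Flow :=
  fun e l => timeAvg (fun t => ∫ ω, p.flow t ω e l ∂p.prob A)

/-- Requirements common to both problems: the flow variables are nonnegative, have finite means,
and the long-term averages that form the flow assignment exist. -/
structure Policy.IsRegular {N : Network V} (p : N.Policy) (A : N.ArrivalLaw) : Prop where
  nonneg : ∀ t, ∀ᵐ ω ∂p.prob A, ∀ e l, 0 ≤ p.flow t ω e l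
  integrable : ∀ t e l, Integrable (fun ω => p.flow t ω e l) (p.prob A)
  hasTimeAvg : ∀ e l, HasTimeAvg (fun t => ∫ ω, p.flow t ω e l ∂p.prob A)

/-- Reliability constraint: the timely throughput is at least `γ ‖λ‖₁`. -/
def Policy.IsReliable {N : Network V} (p : N.Policy) (A : N.ArrivalLaw) (γ : ℝ) : Prop :=
  γ * N.norm1 A.rate ≤ timeAvg (fun t => ∫ ω, N.inflowGe (p.flow t ω) N.dest 1 ∂p.prob A)

/-- Admissibility for the first problem (the actual network): average capacity constraint,
availability constraint with respect to the queues, reliability constraint. -/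
structure Policy.IsAdmissible1 {N : Network V} (p : N.Policy) (A : N.ArrivalLaw) (γ : ℝ) :
    Prop where
  regular : p.IsRegular A
  reliable : p.IsReliable A γ
  capacity : ∀ e, timeAvg (fun t => ∫ ω, ∑ l, p.flow t ω e l ∂p.prob A) ≤ N.capacity e
  availability : ∀ t, ∀ᵐ ω ∂p.prob A, ∀ i, ∀ l ∈ Finset.Icc 1 N.maxLife,
    N.outflow (p.flow t ω) i l ≤ p.backlog t ω i l

/-- Admissibility for the second problem (the virtual network): per-slot capacity constraint,
long-term causality constraint, reliability constraint, no flow out of the destination. -/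
structure Policy.IsAdmissible2 {N : Network V} (p : N.Policy) (A : N.ArrivalLaw) (γ : ℝ) :
    Prop where
  regular : p.IsRegular A
  reliable : p.IsReliable A γ
  capacity : ∀ t, ∀ᵐ ω ∂p.prob A, ∀ e, ∑ l, p.flow t ω e l ≤ N.capacity e
  causality : ∀ i, ∀ l ∈ Finset.Icc 1 N.maxLife,
    timeAvg (fun t => ∫ ω, N.outflowGe (p.flow t ω) i l ∂p.prob A) ≤
      timeAvg (fun t => ∫ ω, N.inflowGe (p.flow t ω) i (l + 1) ∂p.prob A)
        + ∑ k ∈ Finset.Icc l N.maxLife, atLife (A.rate i) k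
  dest_out : ∀ t, ∀ᵐ ω ∂p.prob A, ∀ e : ↥N.links, e.1.1 = N.dest → ∀ l, p.flow t ω e l = 0

/-- Admissible policy space of the first problem. -/
def policySpace1 (N : Network V) (A : N.ArrivalLaw) (γ : ℝ) : Set N.Policy :=
  {p | p.IsAdmissible1 A γ}

/-- Admissible policy space of the second problem. -/
def policySpace2 (N : Network V) (A : N.ArrivalLaw) (γ : ℝ) : Set N.Policy :=
  {p | p.IsAdmissible2 A γ}

/-- Capacity region of the first problem: the pairs `(λ, γ)` for which some arrival process of
mean `λ` admits an admissible policy. -/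
def capacityRegion1 (N : Network V) : Set (N.Arrival × ℝ) :=
  {q | ∃ A : N.ArrivalLaw, A.rate = q.1 ∧ (N.policySpace1 A q.2).Nonempty}

/-- Capacity region of the second problem. -/
def capacityRegion2 (N : Network V) : Set (N.Arrival × ℝ) :=
  {q | ∃ A : N.ArrivalLaw, A.rate = q.1 ∧ (N.policySpace2 A q.2).Nonempty}

/-- Flow space of the first problem: all flow assignments of admissible policies. -/
def flowSpace1 (N : Network V) (A : N.ArrivalLaw) (γ : ℝ) : Set N.Flow :=
  (fun p => p.flowAssignment A) '' N.policySpace1 A γ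

/-- Flow space of the second problem: all flow assignments of admissible policies. -/
def flowSpace2 (N : Network V) (A : N.ArrivalLaw) (γ : ℝ) : Set N.Flow :=
  (fun p => p.flowAssignment A) '' N.policySpace2 A γ

end Network

set_option linter.unusedSectionVars false

/-! Both flow spaces equal the same polytope `IsFeasible`, which depends on the arrival process only
through its rates (`flowSpace1_eq`, `flowSpace2_eq`). A capacity region records when a flow space is
nonempty, so the regions agree too.

Necessity. In the second problem every constraint is linear in the flows and passes to means and
time averages. In the first, causality comes from conservation: up to time `T`, packets that left a
node with lifetime at least `l` had entered it with lifetime at least `l + 1` or arrived from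
outside with lifetime at least `l` (`sum_outflowGe_le`).

Sufficiency. A feasible `f` is itself an admissible constant schedule for the second problem. In the
first, each queue sends fixed fractions of its current backlog, namely `f` divided by the stationary
mean backlog `meanQueue`. Causality says exactly that outflow is at most `meanQueue`, so the
fractions at a queue sum to at most one and availability holds on every path. The recursion is
linear, so mean backlogs obey it with the mean arrivals. It is also triangular in the lifetime, so
they reach `meanQueue` after `maxLife` slots (`fracQueue_eq_meanQueue`), and the mean flow is then
exactly `f`.

The policy spaces are separated on one link: a burst breaks the per-slot capacity, and a constant
schedule sends from a queue that is still empty. -/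

/-- The time averages of `z` converge to `c`. -/
def TendsAvg (z : ℕ → ℝ) (c : ℝ) : Prop :=
  Tendsto (fun T : ℕ => (∑ t ∈ Finset.range T, z t) / (T : ℝ)) atTop (𝓝 c)

/-! ### Calculus of time averages. -/

namespace TendsAvg

theorem timeAvg_eq {z : ℕ → ℝ} {c : ℝ} (h : TendsAvg z c) : timeAvg z = c :=
  Tendsto.limUnder_eq h

theorem of_hasTimeAvg {z : ℕ → ℝ} (h : HasTimeAvg z) : TendsAvg z (timeAvg z) := by
  obtain ⟨c, hc⟩ := h
  have : TendsAvg z c := hc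
  rwa [this.timeAvg_eq]

theorem sum {ι : Type*} (s : Finset ι) {z : ι → ℕ → ℝ} {c : ι → ℝ}
    (h : ∀ i ∈ s, TendsAvg (z i) (c i)) :
    TendsAvg (fun t => ∑ i ∈ s, z i t) (∑ i ∈ s, c i) := by
  refine (tendsto_finsetSum s h).congr fun T => ?_
  rw [Finset.sum_comm, Finset.sum_div]

theorem of_eventually_const {z : ℕ → ℝ} {c : ℝ} {n : ℕ} (h : ∀ t, n ≤ t → z t = c) :
    TendsAvg z c := by
  have hz : Tendsto z atTop (𝓝 c) :=
    tendsto_const_nhds.congr' (by filter_upwards [eventually_ge_atTop n] with t ht; rw [h t ht])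
  refine hz.cesaro.congr fun T => ?_
  rw [div_eq_inv_mul]

theorem const (c : ℝ) : TendsAvg (fun _ => c) c := of_eventually_const (n := 0) fun _ _ => rfl

/-- Comparing partial sums rather than terms matters: conservation at a queue holds cumulatively,
not slot by slot. -/
theorem le_of_sum_le {z w : ℕ → ℝ} {c d : ℝ} (hz : TendsAvg z c) (hw : TendsAvg w d)
    (h : ∀ T, ∑ t ∈ Finset.range T, z t ≤ ∑ t ∈ Finset.range T, w t) : c ≤ d :=
  le_of_tendsto_of_tendsto' hz hw fun T => div_le_div_of_nonneg_right (h T) T.cast_nonneg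

theorem le_of_le {z w : ℕ → ℝ} {c d : ℝ} (hz : TendsAvg z c) (hw : TendsAvg w d)
    (h : ∀ t, z t ≤ w t) : c ≤ d :=
  hz.le_of_sum_le hw fun _ => Finset.sum_le_sum fun t _ => h t

theorem add {z w : ℕ → ℝ} {c d : ℝ} (hz : TendsAvg z c) (hw : TendsAvg w d) :
    TendsAvg (fun t => z t + w t) (c + d) := by
  refine (Tendsto.add hz hw).congr fun T => ?_
  rw [Finset.sum_add_distrib, add_div]

end TendsAvg

/-! ### Lifetime-indexed quantities and their shifted sums. -/

theorem atLife_coe {L : ℕ} (f : Lifetime L → ℝ) (l : Lifetime L) : atLife f l = f l := by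
  simp only [atLife, dif_pos l.2]

theorem atLife_of_notMem {L : ℕ} (f : Lifetime L → ℝ) {l : ℕ} (h : l ∉ Finset.Icc 1 L) :
    atLife f l = 0 := dif_neg h

theorem atLife_nonneg {L : ℕ} {f : Lifetime L → ℝ} (h : ∀ l, 0 ≤ f l) (l : ℕ) :
    0 ≤ atLife f l := by
  unfold atLife; split_ifs
  exacts [h _, le_rfl]

theorem TendsAvg.atLife {L : ℕ} {x : ℕ → Lifetime L → ℝ} {f : Lifetime L → ℝ}
    (h : ∀ l, TendsAvg (fun t => x t l) (f l)) (l : ℕ) :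
    TendsAvg (fun t => atLife (x t) l) (atLife f l) := by
  unfold _root_.atLife; split_ifs
  exacts [h _, .const 0]

section

variable {Ω : Type*} [MeasurableSpace Ω] {μ : Measure Ω} {L : ℕ} {x : Ω → Lifetime L → ℝ}

theorem integrable_atLife (h : ∀ l, Integrable (fun ω => x ω l) μ) (l : ℕ) :
    Integrable (fun ω => atLife (x ω) l) μ := by
  unfold atLife; split_ifs
  exacts [h _, integrable_zero _ _ _]

theorem integral_atLife (l : ℕ) :
    ∫ ω, atLife (x ω) l ∂μ = atLife (fun k => ∫ ω, x ω k ∂μ) l := by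
  unfold atLife; split_ifs <;> simp

theorem measurable_atLife (h : Measurable x) (l : ℕ) : Measurable (fun ω => atLife (x ω) l) := by
  unfold atLife; split_ifs
  exacts [(measurable_pi_apply _).comp h, measurable_const]

end

theorem sum_Icc_succ_of_zero {g : ℕ → ℝ} {l L : ℕ} (hl : l ≤ L) (hg : g (L + 1) = 0) :
    ∑ k ∈ Finset.Icc l L, g (k + 1) = ∑ k ∈ Finset.Icc (l + 1) L, g k := by
  have h1 : ∑ k ∈ Finset.Icc l L, g (k + 1) = ∑ k ∈ Finset.Icc (l + 1) (L + 1), g k := by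
    rw [← Finset.Ico_add_one_right_eq_Icc, ← Finset.Ico_add_one_right_eq_Icc,
      Finset.sum_Ico_add' g]
  rw [h1, Finset.sum_Icc_succ_top (by omega), hg, add_zero]

theorem sum_Icc_eq_add {g : ℕ → ℝ} {l L : ℕ} (hl : l ≤ L) :
    ∑ k ∈ Finset.Icc l L, g k = g l + ∑ k ∈ Finset.Icc (l + 1) L, g k := by
  rw [← Finset.Ico_add_one_right_eq_Icc, ← Finset.Ico_add_one_right_eq_Icc,
    Finset.sum_eq_sum_Ico_succ_bot (by omega)]

namespace Network

variable {V : Type*} [Fintype V] [DecidableEq V] {N : Network V}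

/-! ### Node flows commute with averages and expectations. -/

section Linearity

variable {x : ℕ → N.Flow} {f : N.Flow} {Ω : Type*} [MeasurableSpace Ω] {μ : Measure Ω}
  {X : Ω → N.Flow}

theorem inflow_nonneg (h : ∀ e l, 0 ≤ f e l) (i : V) (l : ℕ) : 0 ≤ N.inflow f i l := by
  refine Finset.sum_nonneg fun e _ => ?_
  split_ifs
  exacts [atLife_nonneg (h e) l, le_rfl]

theorem outflow_nonneg (h : ∀ e l, 0 ≤ f e l) (i : V) (l : ℕ) : 0 ≤ N.outflow f i l := by
  refine Finset.sum_nonneg fun e _ => ?_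
  split_ifs
  exacts [atLife_nonneg (h e) l, le_rfl]

theorem inflow_of_notMem (i : V) {l : ℕ} (h : l ∉ Finset.Icc 1 N.maxLife) :
    N.inflow f i l = 0 := by
  simp [inflow, atLife_of_notMem _ h]

theorem outflow_of_notMem (i : V) {l : ℕ} (h : l ∉ Finset.Icc 1 N.maxLife) :
    N.outflow f i l = 0 := by
  simp [outflow, atLife_of_notMem _ h]

theorem tendsAvg_inflow (h : ∀ e l, TendsAvg (fun t => x t e l) (f e l)) (i : V) (l : ℕ) :
    TendsAvg (fun t => N.inflow (x t) i l) (N.inflow f i l) := by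
  refine TendsAvg.sum _ fun e _ => ?_
  split_ifs
  exacts [TendsAvg.atLife (h e) l, .const 0]

theorem tendsAvg_outflow (h : ∀ e l, TendsAvg (fun t => x t e l) (f e l)) (i : V) (l : ℕ) :
    TendsAvg (fun t => N.outflow (x t) i l) (N.outflow f i l) := by
  refine TendsAvg.sum _ fun e _ => ?_
  split_ifs
  exacts [TendsAvg.atLife (h e) l, .const 0]

theorem integrable_inflow (h : ∀ e l, Integrable (fun ω => X ω e l) μ) (i : V) (l : ℕ) :
    Integrable (fun ω => N.inflow (X ω) i l) μ := by
  refine integrable_finsetSum _ fun e _ => ?_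
  split_ifs
  exacts [integrable_atLife (h e) l, integrable_zero _ _ _]

theorem integrable_outflow (h : ∀ e l, Integrable (fun ω => X ω e l) μ) (i : V) (l : ℕ) :
    Integrable (fun ω => N.outflow (X ω) i l) μ := by
  refine integrable_finsetSum _ fun e _ => ?_
  split_ifs
  exacts [integrable_atLife (h e) l, integrable_zero _ _ _]

theorem integral_inflow (h : ∀ e l, Integrable (fun ω => X ω e l) μ) (i : V) (l : ℕ) :
    ∫ ω, N.inflow (X ω) i l ∂μ = N.inflow (fun e l => ∫ ω, X ω e l ∂μ) i l := by
  unfold inflow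
  rw [integral_finsetSum]
  · refine Finset.sum_congr rfl fun e _ => ?_
    split_ifs
    exacts [integral_atLife l, integral_zero _ _]
  · intro e _
    split_ifs
    exacts [integrable_atLife (h e) l, integrable_zero _ _ _]

theorem integral_outflow (h : ∀ e l, Integrable (fun ω => X ω e l) μ) (i : V) (l : ℕ) :
    ∫ ω, N.outflow (X ω) i l ∂μ = N.outflow (fun e l => ∫ ω, X ω e l ∂μ) i l := by
  unfold outflow
  rw [integral_finsetSum]
  · refine Finset.sum_congr rfl fun e _ => ?_
    split_ifs
    exacts [integral_atLife l, integral_zero _ _]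
  · intro e _
    split_ifs
    exacts [integrable_atLife (h e) l, integrable_zero _ _ _]

theorem integral_inflowGe (h : ∀ e l, Integrable (fun ω => X ω e l) μ) (i : V) (l : ℕ) :
    ∫ ω, N.inflowGe (X ω) i l ∂μ = N.inflowGe (fun e l => ∫ ω, X ω e l ∂μ) i l := by
  unfold inflowGe
  rw [integral_finsetSum _ fun k _ => integrable_inflow h i k]
  exact Finset.sum_congr rfl fun k _ => integral_inflow h i k

theorem integral_outflowGe (h : ∀ e l, Integrable (fun ω => X ω e l) μ) (i : V) (l : ℕ) :
    ∫ ω, N.outflowGe (X ω) i l ∂μ = N.outflowGe (fun e l => ∫ ω, X ω e l ∂μ) i l := by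
  unfold outflowGe
  rw [integral_finsetSum _ fun k _ => integrable_outflow h i k]
  exact Finset.sum_congr rfl fun k _ => integral_outflow h i k

theorem measurable_inflow (h : Measurable X) (i : V) (l : ℕ) :
    Measurable (fun ω => N.inflow (X ω) i l) := by
  refine Finset.measurable_sum _ fun e _ => ?_
  split_ifs
  exacts [measurable_atLife ((measurable_pi_apply e).comp h) l, measurable_const]

theorem measurable_outflow (h : Measurable X) (i : V) (l : ℕ) :
    Measurable (fun ω => N.outflow (X ω) i l) := by
  refine Finset.measurable_sum _ fun e _ => ?_
  split_ifs
  exacts [measurable_atLife ((measurable_pi_apply e).comp h) l, measurable_const]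

end Linearity

theorem queue_of_notMem (a : ℕ → N.Arrival) (x : ℕ → N.Flow) (t : ℕ) (i : V) {l : ℕ}
    (h : l ∉ Finset.Icc 1 N.maxLife) : N.queue a x t i l = 0 := by
  cases t with
  | zero => rfl
  | succ t => rw [queue, if_pos (Or.inr h)]

theorem queue_dest (a : ℕ → N.Arrival) (x : ℕ → N.Flow) (t : ℕ) (l : ℕ) :
    N.queue a x t N.dest l = 0 := by
  cases t with
  | zero => rfl
  | succ t => rw [queue, if_pos (Or.inl rfl)]

/-! ### Necessity: flow assignments lie in the polytope. -/

/-- The flow polytope: nonnegative flows meeting the reliability, capacity and causality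
constraints, with nothing leaving the destination. -/
structure IsFeasible (N : Network V) (lam : N.Arrival) (γ : ℝ) (f : N.Flow) : Prop where
  nonneg : ∀ e l, 0 ≤ f e l
  reliable : γ * N.norm1 lam ≤ N.inflowGe f N.dest 1
  capacity : ∀ e, ∑ l, f e l ≤ N.capacity e
  causality : ∀ i, ∀ l ∈ Finset.Icc 1 N.maxLife,
    N.outflowGe f i l ≤ N.inflowGe f i (l + 1) + ∑ k ∈ Finset.Icc l N.maxLife, atLife (lam i) k
  dest_out : ∀ e : ↥N.links, e.1.1 = N.dest → ∀ l, f e l = 0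

section Policies

variable {p : N.Policy} {A : N.ArrivalLaw}

instance (p : N.Policy) (A : N.ArrivalLaw) : IsProbabilityMeasure (p.prob A) := by
  unfold Policy.prob; infer_instance

theorem measurePreserving_arrival (p : N.Policy) (A : N.ArrivalLaw) (t : ℕ) :
    MeasurePreserving (fun ω : p.Sample => ω.1 t) (p.prob A) A.law :=
  (measurePreserving_eval_infinitePi (fun _ : ℕ => A.law) t).comp measurePreserving_fst

theorem measurable_arrival_apply (i : V) (l : Lifetime N.maxLife) :
    Measurable (fun a : N.Arrival => a i l) :=
  (measurable_pi_apply l).comp (measurable_pi_apply i)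

theorem integrable_arrival_law (A : N.ArrivalLaw) (i : V) (l : Lifetime N.maxLife) :
    Integrable (fun a : N.Arrival => a i l) A.law := by
  obtain ⟨K, hK⟩ := A.bounded
  refine Integrable.of_bound (C := K) (measurable_arrival_apply i l).aestronglyMeasurable ?_
  filter_upwards [hK] with a ha
  rw [Real.norm_of_nonneg (ha i l).1]
  exact (ha i l).2

theorem integrable_arrival (p : N.Policy) (A : N.ArrivalLaw) (t : ℕ) (i : V)
    (l : Lifetime N.maxLife) : Integrable (fun ω : p.Sample => ω.1 t i l) (p.prob A) :=
  (measurePreserving_arrival p A t).integrable_comp_of_integrable (integrable_arrival_law A i l)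

theorem integral_arrival (p : N.Policy) (A : N.ArrivalLaw) (t : ℕ) (i : V)
    (l : Lifetime N.maxLife) : ∫ ω : p.Sample, ω.1 t i l ∂p.prob A = A.rate i l := by
  have hm := measurePreserving_arrival p A t
  rw [ArrivalLaw.rate, ← hm.map_eq, integral_map hm.measurable.aemeasurable
    (measurable_arrival_apply i l).aestronglyMeasurable]

theorem ae_arrival_nonneg (p : N.Policy) (A : N.ArrivalLaw) :
    ∀ᵐ ω ∂p.prob A, ∀ t i l, 0 ≤ ω.1 t i l := by
  obtain ⟨K, hK⟩ := A.bounded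
  refine ae_all_iff.2 fun t => ?_
  filter_upwards [(measurePreserving_arrival p A t).quasiMeasurePreserving.ae hK] with ω h i l
  exact (h i l).1

theorem rate_nonneg (A : N.ArrivalLaw) (i : V) (l : Lifetime N.maxLife) : 0 ≤ A.rate i l := by
  obtain ⟨K, hK⟩ := A.bounded
  refine integral_nonneg_of_ae ?_
  filter_upwards [hK] with a ha using (ha i l).1

theorem Policy.IsRegular.tendsAvg (h : p.IsRegular A) (e : ↥N.links) (l : Lifetime N.maxLife) :
    TendsAvg (fun t => ∫ ω, p.flow t ω e l ∂p.prob A) (p.flowAssignment A e l) :=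
  .of_hasTimeAvg (h.hasTimeAvg e l)

theorem Policy.IsRegular.flowAssignment_nonneg (h : p.IsRegular A) (e : ↥N.links)
    (l : Lifetime N.maxLife) : 0 ≤ p.flowAssignment A e l := by
  refine (TendsAvg.const 0).le_of_le (h.tendsAvg e l) fun t => integral_nonneg_of_ae ?_
  filter_upwards [h.nonneg t] with ω hω using hω e l

theorem Policy.IsRegular.tendsAvg_inflowGe (h : p.IsRegular A) (i : V) (l : ℕ) :
    TendsAvg (fun t => ∫ ω, N.inflowGe (p.flow t ω) i l ∂p.prob A)
      (N.inflowGe (p.flowAssignment A) i l) := by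
  simp_rw [fun t => integral_inflowGe (h.integrable t) i l]
  exact TendsAvg.sum _ fun k _ => tendsAvg_inflow h.tendsAvg i k

theorem Policy.IsRegular.tendsAvg_outflowGe (h : p.IsRegular A) (i : V) (l : ℕ) :
    TendsAvg (fun t => ∫ ω, N.outflowGe (p.flow t ω) i l ∂p.prob A)
      (N.outflowGe (p.flowAssignment A) i l) := by
  simp_rw [fun t => integral_outflowGe (h.integrable t) i l]
  exact TendsAvg.sum _ fun k _ => tendsAvg_outflow h.tendsAvg i k

theorem Policy.IsRegular.tendsAvg_total (h : p.IsRegular A) (e : ↥N.links) :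
    TendsAvg (fun t => ∫ ω, ∑ l, p.flow t ω e l ∂p.prob A) (∑ l, p.flowAssignment A e l) := by
  simp_rw [fun t => integral_finsetSum Finset.univ
    (f := fun l ω => p.flow t ω e l) (μ := p.prob A) fun l _ => h.integrable t e l]
  exact TendsAvg.sum _ fun l _ => h.tendsAvg e l

theorem Policy.IsRegular.isReliable_iff (h : p.IsRegular A) (γ : ℝ) :
    p.IsReliable A γ ↔ γ * N.norm1 A.rate ≤ N.inflowGe (p.flowAssignment A) N.dest 1 := by
  rw [Policy.IsReliable, (h.tendsAvg_inflowGe _ _).timeAvg_eq]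

theorem Policy.IsAdmissible2.isFeasible {γ : ℝ} (h : p.IsAdmissible2 A γ) :
    N.IsFeasible A.rate γ (p.flowAssignment A) where
  nonneg := h.regular.flowAssignment_nonneg
  reliable := (h.regular.isReliable_iff γ).1 h.reliable
  capacity e := by
    refine (h.regular.tendsAvg_total e).le_of_le (.const _) fun t => ?_
    calc ∫ ω, ∑ l, p.flow t ω e l ∂p.prob A ≤ ∫ _, N.capacity e ∂p.prob A := by
          refine integral_mono_ae (integrable_finsetSum _ fun l _ => h.regular.integrable t e l)
            (integrable_const _) ?_
          filter_upwards [h.capacity t] with ω hω using hω e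
      _ = N.capacity e := by simp
  causality i l hl := by
    have := h.causality i l hl
    rwa [(h.regular.tendsAvg_outflowGe _ _).timeAvg_eq,
      (h.regular.tendsAvg_inflowGe _ _).timeAvg_eq] at this
  dest_out e he l := by
    refine (TendsAvg.of_eventually_const (n := 0) fun t _ => ?_).timeAvg_eq
    refine integral_eq_zero_of_ae ?_
    filter_upwards [h.dest_out t] with ω hω using hω e he l

/-- Packets leaving a node were present there with at least the same lifetime: pathwise
cumulative form of the causality constraint. -/
theorem sum_outflowGe_le {a : ℕ → N.Arrival} {x : ℕ → N.Flow} (hx : ∀ t e l, 0 ≤ x t e l)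
    (hq : ∀ t i, ∀ l ∈ Finset.Icc 1 N.maxLife, N.outflow (x t) i l ≤ N.queue a x t i l)
    {i : V} (hi : i ≠ N.dest) {l : ℕ} (hl : l ∈ Finset.Icc 1 N.maxLife) (T : ℕ) :
    ∑ t ∈ Finset.range T, N.outflowGe (x t) i l ≤ ∑ t ∈ Finset.range T,
      (N.inflowGe (x t) i (l + 1) + ∑ k ∈ Finset.Icc l N.maxLife, atLife (a t i) k) := by
  obtain ⟨hl1, hlL⟩ := Finset.mem_Icc.1 hl
  set S : ℕ → ℝ := fun t => ∑ k ∈ Finset.Icc l N.maxLife, N.queue a x t i k with hS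
  -- One-slot balance for the backlog of lifetime at least `l`. The slack is the unsent part of the
  -- lifetime-`l` queue, which ages out of `S`; availability makes it nonnegative.
  have hstep (t : ℕ) : S (t + 1) + N.outflowGe (x t) i l ≤
      S t + (N.inflowGe (x t) i (l + 1) + ∑ k ∈ Finset.Icc l N.maxLife, atLife (a t i) k) := by
    have hL : N.maxLife + 1 ∉ Finset.Icc 1 N.maxLife := by simp
    have h1 : S (t + 1) = ∑ k ∈ Finset.Icc l N.maxLife, (N.queue a x t i (k + 1)
        - N.outflow (x t) i (k + 1) + N.inflow (x t) i (k + 1) + atLife (a t i) k) := by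
      refine Finset.sum_congr rfl fun k hk => ?_
      rw [queue, if_neg]
      rw [Finset.mem_Icc] at hk
      simp only [not_or, not_not, Finset.mem_Icc]
      exact ⟨hi, by omega⟩
    have h2 : S t = N.queue a x t i l
        + ∑ k ∈ Finset.Icc (l + 1) N.maxLife, N.queue a x t i k := sum_Icc_eq_add hlL
    have h3 : N.outflowGe (x t) i l = N.outflow (x t) i l
        + ∑ k ∈ Finset.Icc (l + 1) N.maxLife, N.outflow (x t) i k := sum_Icc_eq_add hlL
    rw [h1, h2, h3, Finset.sum_add_distrib, Finset.sum_add_distrib, Finset.sum_sub_distrib,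
      sum_Icc_succ_of_zero hlL (queue_of_notMem a x t i hL),
      sum_Icc_succ_of_zero (g := N.outflow (x t) i) hlL (outflow_of_notMem i hL),
      sum_Icc_succ_of_zero (g := N.inflow (x t) i) hlL (inflow_of_notMem i hL), inflowGe]
    linarith [hq t i l hl]
  have hsum : ∀ T, S T + ∑ t ∈ Finset.range T, N.outflowGe (x t) i l ≤ ∑ t ∈ Finset.range T,
      (N.inflowGe (x t) i (l + 1) + ∑ k ∈ Finset.Icc l N.maxLife, atLife (a t i) k) := by
    intro T
    induction T with
    | zero => simp [hS, queue]
    | succ T ih =>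
      rw [Finset.sum_range_succ, Finset.sum_range_succ]
      linarith [hstep T]
  -- Availability also bounds each backlog below by a nonnegative outflow, so the final backlog can
  -- be discarded.
  have hpos : 0 ≤ S T := by
    refine Finset.sum_nonneg fun k hk => ?_
    rw [Finset.mem_Icc] at hk
    exact (outflow_nonneg (hx T) i k).trans (hq T i k (Finset.mem_Icc.2 (by omega)))
  linarith [hsum T]

theorem eq_zero_of_outflow_le_zero {x : N.Flow} (hx : ∀ e l, 0 ≤ x e l) {e : ↥N.links}
    {l : Lifetime N.maxLife} (h : N.outflow x e.1.1 l ≤ 0) : x e l = 0 := by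
  refine le_antisymm ?_ (hx e l)
  refine le_trans ?_ h
  have := Finset.single_le_sum (s := Finset.univ)
    (f := fun e' : ↥N.links => if e'.1.1 = e.1.1 then atLife (x e') l else 0)
    (fun e' _ => by
      split_ifs
      exacts [atLife_nonneg (hx e') l, le_rfl]) (Finset.mem_univ e)
  rwa [if_pos rfl, atLife_coe] at this

theorem outflow_eq_zero {f : N.Flow} {i : V} (h : ∀ e : ↥N.links, e.1.1 = i → ∀ l, f e l = 0)
    (l : ℕ) : N.outflow f i l = 0 := by
  refine Finset.sum_eq_zero fun e _ => ?_
  split_ifs with he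
  · unfold atLife
    split_ifs
    exacts [h e he _, rfl]
  · rfl

theorem Policy.IsAdmissible1.isFeasible {γ : ℝ} (h : p.IsAdmissible1 A γ) :
    N.IsFeasible A.rate γ (p.flowAssignment A) := by
  -- The destination's queue is always zero, so availability forbids sending from it.
  have hdest : ∀ e : ↥N.links, e.1.1 = N.dest → ∀ l, p.flowAssignment A e l = 0 := by
    intro e he l
    refine (TendsAvg.of_eventually_const (n := 0) fun t _ => ?_).timeAvg_eq
    refine integral_eq_zero_of_ae ?_
    filter_upwards [h.availability t, h.regular.nonneg t] with ω hq hx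
    refine eq_zero_of_outflow_le_zero hx ?_
    have := hq e.1.1 l l.2
    rwa [Policy.backlog, he, queue_dest, ← he] at this
  refine ⟨h.regular.flowAssignment_nonneg, (h.regular.isReliable_iff γ).1 h.reliable,
    fun e => ?_, fun i l hl => ?_, hdest⟩
  · have := h.capacity e
    rwa [(h.regular.tendsAvg_total e).timeAvg_eq] at this
  -- The queue recursion fails at the destination, but causality is trivial there: zero outflow
  -- against nonnegative terms.
  · by_cases hi : i = N.dest
    · subst hi
      rw [outflowGe, Finset.sum_eq_zero fun k _ => outflow_eq_zero hdest k]
      exact add_nonneg (Finset.sum_nonneg fun k _ =>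
          inflow_nonneg h.regular.flowAssignment_nonneg _ _)
        (Finset.sum_nonneg fun k _ => atLife_nonneg (rate_nonneg A _) _)
    refine (h.regular.tendsAvg_outflowGe i l).le_of_sum_le
      ((h.regular.tendsAvg_inflowGe i (l + 1)).add (.const _)) fun T => ?_
    have hout (t : ℕ) : Integrable (fun ω => N.outflowGe (p.flow t ω) i l) (p.prob A) :=
      integrable_finsetSum _ fun k _ => integrable_outflow (h.regular.integrable t) i k
    have hin (t : ℕ) : Integrable (fun ω => N.inflowGe (p.flow t ω) i (l + 1)) (p.prob A) :=
      integrable_finsetSum _ fun k _ => integrable_inflow (h.regular.integrable t) i k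
    have harr (t : ℕ) : Integrable (fun ω : p.Sample =>
        ∑ k ∈ Finset.Icc l N.maxLife, atLife (ω.1 t i) k) (p.prob A) :=
      integrable_finsetSum _ fun k _ => integrable_atLife (integrable_arrival p A t i) k
    have hrate (t : ℕ) : ∫ ω, ∑ k ∈ Finset.Icc l N.maxLife, atLife (ω.1 t i) k ∂p.prob A
        = ∑ k ∈ Finset.Icc l N.maxLife, atLife (A.rate i) k := by
      rw [integral_finsetSum _ fun k _ => integrable_atLife (integrable_arrival p A t i) k]
      refine Finset.sum_congr rfl fun k _ => ?_
      rw [integral_atLife]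
      simp_rw [integral_arrival]
    have hmono : ∫ ω, ∑ t ∈ Finset.range T, N.outflowGe (p.flow t ω) i l ∂p.prob A ≤
        ∫ ω, ∑ t ∈ Finset.range T, (N.inflowGe (p.flow t ω) i (l + 1)
          + ∑ k ∈ Finset.Icc l N.maxLife, atLife (ω.1 t i) k) ∂p.prob A := by
      refine integral_mono_ae (integrable_finsetSum _ fun t _ => hout t)
        (integrable_finsetSum _ fun t _ => (hin t).add (harr t)) ?_
      filter_upwards [ae_all_iff.2 h.availability, ae_all_iff.2 h.regular.nonneg] with ω hq hx
      exact sum_outflowGe_le hx hq hi hl T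
    rw [integral_finsetSum _ fun t _ => hout t,
      integral_finsetSum _ fun t _ => by exact (hin t).add (harr t)] at hmono
    refine hmono.trans_eq (Finset.sum_congr rfl fun t _ => ?_)
    rw [integral_add (hin t) (harr t), hrate]

end Policies

end Network

namespace Network

variable {V : Type*} [Fintype V] [DecidableEq V] {N : Network V}

/-! ### Sufficiency for the second problem: fixed schedules. -/

/-- The policy that follows a fixed schedule, irrespective of the arrivals. -/
noncomputable def schedule (N : Network V) (x : ℕ → N.Flow) : N.Policy where
  Seed := Unit
  seedSpace := ⊤
  seedLaw := Measure.dirac ()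
  isProb := inferInstance
  decision t _ _ := x t
  measurable_decision _ := measurable_const

theorem flow_schedule (x : ℕ → N.Flow) (t : ℕ) (ω : (N.schedule x).Sample) :
    (N.schedule x).flow t ω = x t := rfl

theorem integral_schedule (x : ℕ → N.Flow) (A : N.ArrivalLaw) (t : ℕ) (e : ↥N.links)
    (l : Lifetime N.maxLife) :
    ∫ ω, (N.schedule x).flow t ω e l ∂(N.schedule x).prob A = x t e l := by
  simp [flow_schedule]

theorem flowAssignment_eq {p : N.Policy} {A : N.ArrivalLaw} {f : N.Flow}
    (h : ∀ e l, TendsAvg (fun t => ∫ ω, p.flow t ω e l ∂p.prob A) (f e l)) :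
    p.flowAssignment A = f :=
  funext fun e => funext fun l => (h e l).timeAvg_eq

theorem isRegular_schedule {x : ℕ → N.Flow} {f : N.Flow} (A : N.ArrivalLaw)
    (hx : ∀ t e l, 0 ≤ x t e l) (hf : ∀ e l, TendsAvg (fun t => x t e l) (f e l)) :
    (N.schedule x).IsRegular A where
  nonneg t := .of_forall fun _ => hx t
  integrable t e l := by
    simp only [flow_schedule]
    exact integrable_const _
  hasTimeAvg e l := by
    simp only [integral_schedule]
    exact ⟨f e l, hf e l⟩

theorem flowAssignment_schedule {x : ℕ → N.Flow} {f : N.Flow} (A : N.ArrivalLaw)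
    (hf : ∀ e l, TendsAvg (fun t => x t e l) (f e l)) :
    (N.schedule x).flowAssignment A = f :=
  flowAssignment_eq fun e l => by simpa only [integral_schedule] using hf e l

/-- Since no constraint here refers to actual queues, sending `f` in every slot meets the averaged
and the per-slot requirements alike. -/
theorem IsFeasible.isAdmissible2 {A : N.ArrivalLaw} {γ : ℝ} {f : N.Flow}
    (h : N.IsFeasible A.rate γ f) : (N.schedule fun _ => f).IsAdmissible2 A γ := by
  have hreg := isRegular_schedule A (fun _ => h.nonneg) fun e l => TendsAvg.const (f e l)
  have hfa := flowAssignment_schedule A fun e l => TendsAvg.const (f e l)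
  refine ⟨hreg, (hreg.isReliable_iff γ).2 (by rw [hfa]; exact h.reliable), fun t => .of_forall fun _ =>
    h.capacity, fun i l hl => ?_, fun t => .of_forall fun _ => h.dest_out⟩
  rw [(hreg.tendsAvg_outflowGe _ _).timeAvg_eq, (hreg.tendsAvg_inflowGe _ _).timeAvg_eq, hfa]
  exact h.causality i l hl

theorem flowSpace2_eq (A : N.ArrivalLaw) (γ : ℝ) :
    N.flowSpace2 A γ = {f | N.IsFeasible A.rate γ f} := by
  ext f
  constructor
  · rintro ⟨p, hp, rfl⟩
    exact Policy.IsAdmissible2.isFeasible hp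
  · intro hf
    exact ⟨_, IsFeasible.isAdmissible2 hf,
      flowAssignment_schedule A fun e l => TendsAvg.const (f e l)⟩

/-! ### Fractional forwarding and its queue recursion. -/

/-- Send the fraction `c e l` of the lifetime-`l` backlog at the tail of `e` over `e`. -/
def fracFlow (N : Network V) (c : N.Flow) (Q : V → ℕ → ℝ) : N.Flow :=
  fun e l => c e l * Q e.1.1 l

/-- Queue backlogs when every link is served by `fracFlow`. -/
def fracQueue (N : Network V) (c : N.Flow) (a : ℕ → N.Arrival) : ℕ → V → ℕ → ℝ
  | 0, _, _ => 0
  | t + 1, i, l =>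
    if i = N.dest ∨ l ∉ Finset.Icc 1 N.maxLife then 0
    else N.fracQueue c a t i (l + 1) - N.outflow (N.fracFlow c (N.fracQueue c a t)) i (l + 1)
      + N.inflow (N.fracFlow c (N.fracQueue c a t)) i (l + 1) + atLife (a t i) l

/-- Flows depend on backlogs and backlogs on flows; `fracQueue` resolves this circularity in one
recursion, and here it is matched with the true queues. -/
theorem queue_fracFlow (c : N.Flow) (a : ℕ → N.Arrival) (t : ℕ) :
    N.queue a (fun s => N.fracFlow c (N.fracQueue c a s)) t = N.fracQueue c a t := by
  induction t with
  | zero => rfl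
  | succ t ih =>
    funext i l
    rw [queue, fracQueue, ih]

/-- Causality of fractional forwarding: it lets a finite history be padded arbitrarily in
`fracPolicy`. -/
theorem fracQueue_congr (c : N.Flow) {a b : ℕ → N.Arrival} {t : ℕ} (h : ∀ s < t, a s = b s) :
    N.fracQueue c a t = N.fracQueue c b t := by
  induction t with
  | zero => rfl
  | succ t ih =>
    funext i l
    rw [fracQueue, fracQueue, ih fun s hs => h s (by omega), h t (by omega)]

theorem outflow_fracFlow (c : N.Flow) (Q : V → ℕ → ℝ) (i : V) (l : ℕ) :
    N.outflow (N.fracFlow c Q) i l = N.outflow c i l * Q i l := by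
  unfold outflow
  rw [Finset.sum_mul]
  refine Finset.sum_congr rfl fun e _ => ?_
  split_ifs with he
  · unfold atLife fracFlow
    split_ifs
    · rw [he]
    · rw [zero_mul]
  · rw [zero_mul]

theorem fracQueue_nonneg {c : N.Flow} {a : ℕ → N.Arrival} (hc : ∀ e l, 0 ≤ c e l)
    (hc1 : ∀ i l, N.outflow c i l ≤ 1) (ha : ∀ t i l, 0 ≤ a t i l) (t : ℕ) (i : V) (l : ℕ) :
    0 ≤ N.fracQueue c a t i l := by
  induction t generalizing i l with
  | zero => exact le_rfl
  | succ t ih =>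
    rw [fracQueue]
    split_ifs
    · exact le_rfl
    · rw [outflow_fracFlow]
      have h1 := mul_le_of_le_one_left (ih i (l + 1)) (hc1 i (l + 1))
      have h2 : 0 ≤ N.inflow (N.fracFlow c (N.fracQueue c a t)) i (l + 1) :=
        inflow_nonneg (fun e l => mul_nonneg (hc e l) (ih _ _)) _ _
      have h3 := atLife_nonneg (ha t i) l
      linarith

section Random

variable {Ω : Type*} [MeasurableSpace Ω] {μ : Measure Ω} {a : ℕ → Ω → N.Arrival}

theorem measurable_fracFlow (c : N.Flow) {Q : Ω → V → ℕ → ℝ}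
    (h : ∀ i l, Measurable fun ω => Q ω i l) : Measurable fun ω => N.fracFlow c (Q ω) :=
  measurable_pi_lambda _ fun e => measurable_pi_lambda _ fun l => (h e.1.1 l).const_mul (c e l)

theorem measurable_fracQueue (c : N.Flow) (ha : ∀ t, Measurable (a t)) (t : ℕ) (i : V) (l : ℕ) :
    Measurable fun ω => N.fracQueue c (fun s => a s ω) t i l := by
  induction t generalizing i l with
  | zero => exact measurable_const
  | succ t ih =>
    simp only [fracQueue]
    split_ifs
    · exact measurable_const
    · exact (((ih _ _).sub (measurable_outflow (measurable_fracFlow c ih) _ _)).add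
        (measurable_inflow (measurable_fracFlow c ih) _ _)).add
        (measurable_atLife ((measurable_pi_apply i).comp (ha t)) l)

theorem integrable_fracQueue (c : N.Flow) (ha : ∀ t i l, Integrable (fun ω => a t ω i l) μ)
    (t : ℕ) (i : V) (l : ℕ) : Integrable (fun ω => N.fracQueue c (fun s => a s ω) t i l) μ := by
  induction t generalizing i l with
  | zero => exact integrable_zero _ _ _
  | succ t ih =>
    simp only [fracQueue]
    have hx (e : ↥N.links) (l : Lifetime N.maxLife) :
        Integrable (fun ω => N.fracFlow c (N.fracQueue c (fun s => a s ω) t) e l) μ :=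
      (ih e.1.1 l).const_mul (c e l)
    split_ifs
    · exact integrable_zero _ _ _
    · exact (((ih _ _).sub (integrable_outflow hx _ _)).add (integrable_inflow hx _ _)).add
        (integrable_atLife (ha t i) l)

/-- The mean backlogs follow the queue recursion driven by the mean arrivals. -/
theorem integral_fracQueue (c : N.Flow) (ha : ∀ t i l, Integrable (fun ω => a t ω i l) μ)
    (t : ℕ) (i : V) (l : ℕ) : ∫ ω, N.fracQueue c (fun s => a s ω) t i l ∂μ =
      N.fracQueue c (fun s i l => ∫ ω, a s ω i l ∂μ) t i l := by
  induction t generalizing i l with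
  | zero => exact integral_zero _ _
  | succ t ih =>
    have hx (e : ↥N.links) (l : Lifetime N.maxLife) :
        Integrable (fun ω => N.fracFlow c (N.fracQueue c (fun s => a s ω) t) e l) μ :=
      (integrable_fracQueue c ha t e.1.1 l).const_mul (c e l)
    have hX : (fun e l => ∫ ω, N.fracFlow c (N.fracQueue c (fun s => a s ω) t) e l ∂μ)
        = N.fracFlow c (N.fracQueue c (fun s i l => ∫ ω, a s ω i l ∂μ) t) := by
      funext e l
      simp only [fracFlow, integral_const_mul, ih]
    simp only [fracQueue]
    split_ifs
    · exact integral_zero _ _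
    · have h1 := integrable_fracQueue c ha t i (l + 1)
      have h2 := integrable_outflow hx i (l + 1)
      have h3 := integrable_inflow hx i (l + 1)
      have h4 := integrable_atLife (ha t i) l
      rw [integral_add (by exact (h1.sub h2).add h3) h4, integral_add (by exact h1.sub h2) h3,
        integral_sub h1 h2, integral_outflow hx, integral_inflow hx, hX, ih, integral_atLife]

end Random

/-! ### Stationary mean backlogs and the splitting fractions. -/

/-- The stationary mean backlogs that support the flow `f` under arrival rates `lam`. -/
noncomputable def meanQueue (N : Network V) (lam : N.Arrival) (f : N.Flow) (i : V) (l : ℕ) : ℝ :=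
  if i = N.dest ∨ l ∉ Finset.Icc 1 N.maxLife then 0
  else N.inflowGe f i (l + 1) - N.outflowGe f i (l + 1)
    + ∑ k ∈ Finset.Icc l N.maxLife, atLife (lam i) k

theorem meanQueue_of_notMem (lam : N.Arrival) (f : N.Flow) (i : V) {l : ℕ}
    (h : l ∉ Finset.Icc 1 N.maxLife) : N.meanQueue lam f i l = 0 := if_pos (Or.inr h)

/-- This is the fixed-point equation of the mean queue recursion. The defining sums telescope in
`l`; at `l = maxLife` every term of lifetime `l + 1` vanishes. -/
theorem meanQueue_eq (lam : N.Arrival) (f : N.Flow) {i : V} (hi : i ≠ N.dest) {l : ℕ}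
    (hl : l ∈ Finset.Icc 1 N.maxLife) : N.meanQueue lam f i l = N.meanQueue lam f i (l + 1)
      - N.outflow f i (l + 1) + N.inflow f i (l + 1) + atLife (lam i) l := by
  obtain ⟨hl1, hlL⟩ := Finset.mem_Icc.1 hl
  rw [meanQueue, if_neg (by simp only [not_or, not_not]; exact ⟨hi, hl⟩), sum_Icc_eq_add hlL]
  rcases hlL.eq_or_lt with h | h
  · have hL : l + 1 ∉ Finset.Icc 1 N.maxLife := by simp [h]
    rw [meanQueue_of_notMem lam f i hL, outflow_of_notMem i hL, inflow_of_notMem i hL,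
      inflowGe, outflowGe, Finset.Icc_eq_empty (by omega)]
    simp
  · rw [meanQueue, if_neg (by simp only [not_or, not_not, Finset.mem_Icc]; exact ⟨hi, by omega⟩),
      inflowGe, outflowGe, sum_Icc_eq_add (g := N.inflow f i) h,
      sum_Icc_eq_add (g := N.outflow f i) h, inflowGe, outflowGe]
    ring

/-- Fractions of the stationary backlogs that make up the flow `f`. -/
noncomputable def splitting (N : Network V) (lam : N.Arrival) (f : N.Flow) : N.Flow :=
  fun e l => f e l / N.meanQueue lam f e.1.1 l

namespace IsFeasible

variable {lam : N.Arrival} {γ : ℝ} {f : N.Flow}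

/-- Away from the destination this is the causality constraint with the lifetime-`l` outflow
isolated. -/
theorem outflow_le_meanQueue (h : N.IsFeasible lam γ f) (i : V) (l : ℕ) :
    N.outflow f i l ≤ N.meanQueue lam f i l := by
  by_cases hl : l ∈ Finset.Icc 1 N.maxLife
  · by_cases hi : i = N.dest
    · rw [meanQueue, if_pos (Or.inl hi)]
      exact (outflow_eq_zero (fun e he => h.dest_out e (he.trans hi)) l).le
    · rw [meanQueue, if_neg (by simp only [not_or, not_not]; exact ⟨hi, hl⟩)]
      have h1 := h.causality i l hl
      rw [outflowGe, sum_Icc_eq_add (Finset.mem_Icc.1 hl).2] at h1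
      rw [outflowGe]
      linarith
  · rw [outflow_of_notMem i hl, meanQueue_of_notMem lam f i hl]

theorem meanQueue_nonneg (h : N.IsFeasible lam γ f) (i : V) (l : ℕ) :
    0 ≤ N.meanQueue lam f i l :=
  (outflow_nonneg h.nonneg i l).trans (h.outflow_le_meanQueue i l)

theorem splitting_nonneg (h : N.IsFeasible lam γ f) (e : ↥N.links) (l : Lifetime N.maxLife) :
    0 ≤ N.splitting lam f e l :=
  div_nonneg (h.nonneg e l) (h.meanQueue_nonneg _ _)

theorem fracFlow_splitting (h : N.IsFeasible lam γ f) :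
    N.fracFlow (N.splitting lam f) (N.meanQueue lam f) = f := by
  funext e l
  rw [fracFlow, splitting]
  -- Division by an empty mean queue does no harm: `f` vanishes on the links it feeds.
  by_cases hq : N.meanQueue lam f e.1.1 l = 0
  · rw [hq, mul_zero]
    exact (eq_zero_of_outflow_le_zero h.nonneg (hq ▸ h.outflow_le_meanQueue e.1.1 l)).symm
  · exact div_mul_cancel₀ _ hq

theorem outflow_splitting_le (h : N.IsFeasible lam γ f) (i : V) (l : ℕ) :
    N.outflow (N.splitting lam f) i l ≤ 1 := by
  have h1 : N.outflow (N.splitting lam f) i l = N.outflow f i l / N.meanQueue lam f i l := by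
    unfold outflow
    rw [Finset.sum_div]
    refine Finset.sum_congr rfl fun e _ => ?_
    split_ifs with he
    · unfold atLife splitting
      split_ifs
      · rw [he]
      · rw [zero_div]
    · rw [zero_div]
  rw [h1]
  exact div_le_one_of_le₀ (h.outflow_le_meanQueue i l) (h.meanQueue_nonneg i l)

/-- Lifetime-`l` backlogs only depend on longer lifetimes, so the mean backlogs become
stationary after finitely many slots. -/
theorem fracQueue_eq_meanQueue (h : N.IsFeasible lam γ f) {t l : ℕ} (htl : N.maxLife < t + l)
    (i : V) : N.fracQueue (N.splitting lam f) (fun _ => lam) t i l = N.meanQueue lam f i l := by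
  induction t generalizing i l with
  -- At `t = 0` the hypothesis forces `l > maxLife`, where both sides vanish.
  | zero => rw [meanQueue_of_notMem lam f i (by simp; omega), fracQueue]
  | succ t ih =>
    have ih' (i : V) := ih (l := l + 1) (by omega) i
    -- The induction hypothesis covers lifetime `l + 1` at time `t`, and the recursion needs the
    -- flows at that lifetime only.
    have hfl (e : ↥N.links) : atLife (N.fracFlow (N.splitting lam f)
        (N.fracQueue (N.splitting lam f) (fun _ => lam) t) e) (l + 1) = atLife (f e) (l + 1) := by
      conv_rhs => rw [← h.fracFlow_splitting]
      unfold atLife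
      split_ifs
      · simp only [fracFlow, ih']
      · rfl
    rw [fracQueue]
    split_ifs with hc
    · rw [meanQueue, if_pos hc]
    · simp only [not_or, not_not] at hc
      rw [meanQueue_eq lam f hc.1 hc.2, ih']
      simp only [outflow, inflow, hfl]

end IsFeasible

/-! ### Sufficiency for the first problem: the fractional policy. -/

/-- Extension of a finite arrival history by zero. -/
def extendHistory (N : Network V) (t : ℕ) (h : Fin t → N.Arrival) (s : ℕ) : N.Arrival :=
  if hs : s < t then h ⟨s, hs⟩ else 0

theorem measurable_extendHistory (t s : ℕ) :
    Measurable fun h : Fin t → N.Arrival => N.extendHistory t h s := by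
  unfold extendHistory
  split_ifs
  exacts [measurable_pi_apply _, measurable_const]

/-- The policy that always sends the fractions `c` of the current backlogs. -/
noncomputable def fracPolicy (N : Network V) (c : N.Flow) : N.Policy where
  Seed := Unit
  seedSpace := ⊤
  seedLaw := Measure.dirac ()
  isProb := inferInstance
  decision t h _ := N.fracFlow c (N.fracQueue c (N.extendHistory t h) t)
  measurable_decision t :=
    (measurable_fracFlow c (measurable_fracQueue c (measurable_extendHistory t) t)).comp
      measurable_fst

theorem flow_fracPolicy (c : N.Flow) (t : ℕ) (ω : (N.fracPolicy c).Sample) :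
    (N.fracPolicy c).flow t ω = N.fracFlow c (N.fracQueue c ω.1 t) := by
  change N.fracFlow c (N.fracQueue c (N.extendHistory t fun s => ω.1 s) t) = _
  rw [fracQueue_congr c fun s hs => ?_]
  simp only [extendHistory, dif_pos hs]

theorem backlog_fracPolicy (c : N.Flow) (t : ℕ) (ω : (N.fracPolicy c).Sample) :
    (N.fracPolicy c).backlog t ω = N.fracQueue c ω.1 t := by
  simp only [Policy.backlog, flow_fracPolicy, queue_fracFlow]

namespace IsFeasible

variable {A : N.ArrivalLaw} {γ : ℝ} {f : N.Flow}

theorem tendsAvg_fracPolicy (h : N.IsFeasible A.rate γ f) (e : ↥N.links)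
    (l : Lifetime N.maxLife) :
    TendsAvg (fun t => ∫ ω, (N.fracPolicy (N.splitting A.rate f)).flow t ω e l
      ∂(N.fracPolicy (N.splitting A.rate f)).prob A) (f e l) := by
  -- Lifetimes are at least one, so `t ≥ maxLife` already gives `maxLife < t + l`.
  refine TendsAvg.of_eventually_const (n := N.maxLife) fun t ht => ?_
  have hl := (Finset.mem_Icc.1 l.2).1
  simp only [flow_fracPolicy, fracFlow]
  rw [integral_const_mul, integral_fracQueue _ (integrable_arrival _ A)]
  simp only [integral_arrival]
  rw [h.fracQueue_eq_meanQueue (by omega)]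
  exact congrFun (congrFun h.fracFlow_splitting e) l

theorem isRegular_fracPolicy (h : N.IsFeasible A.rate γ f) :
    (N.fracPolicy (N.splitting A.rate f)).IsRegular A where
  nonneg t := by
    filter_upwards [ae_arrival_nonneg _ A] with ω hω e l
    rw [flow_fracPolicy]
    exact mul_nonneg (h.splitting_nonneg e l)
      (fracQueue_nonneg h.splitting_nonneg h.outflow_splitting_le hω _ _ _)
  integrable t e l := by
    simp only [flow_fracPolicy]
    exact (integrable_fracQueue _ (integrable_arrival _ A) t e.1.1 l).const_mul _
  hasTimeAvg e l := ⟨f e l, h.tendsAvg_fracPolicy e l⟩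

theorem isAdmissible1 (h : N.IsFeasible A.rate γ f) :
    (N.fracPolicy (N.splitting A.rate f)).IsAdmissible1 A γ := by
  have hreg := h.isRegular_fracPolicy
  have hfa := flowAssignment_eq h.tendsAvg_fracPolicy
  refine ⟨hreg, (hreg.isReliable_iff γ).2 (by rw [hfa]; exact h.reliable), fun e => ?_, fun t => ?_⟩
  · rw [(hreg.tendsAvg_total e).timeAvg_eq, hfa]
    exact h.capacity e
  · filter_upwards [ae_arrival_nonneg _ A] with ω hω i l _
    rw [flow_fracPolicy, backlog_fracPolicy, outflow_fracFlow]
    exact mul_le_of_le_one_left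
      (fracQueue_nonneg h.splitting_nonneg h.outflow_splitting_le hω _ _ _)
      (h.outflow_splitting_le i l)

end IsFeasible

theorem flowSpace1_eq (A : N.ArrivalLaw) (γ : ℝ) :
    N.flowSpace1 A γ = {f | N.IsFeasible A.rate γ f} := by
  ext f
  constructor
  · rintro ⟨p, hp, rfl⟩
    exact Policy.IsAdmissible1.isFeasible hp
  · intro hf
    exact ⟨_, IsFeasible.isAdmissible1 hf, flowAssignment_eq hf.tendsAvg_fracPolicy⟩

theorem flowSpace1_eq_flowSpace2 (A : N.ArrivalLaw) (γ : ℝ) :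
    N.flowSpace1 A γ = N.flowSpace2 A γ := by
  rw [flowSpace1_eq, flowSpace2_eq]

theorem capacityRegion1_eq_capacityRegion2 (N : Network V) :
    N.capacityRegion1 = N.capacityRegion2 := by
  ext q
  refine exists_congr fun A => and_congr_right fun _ => ?_
  -- A policy space is nonempty exactly when its image, the flow space, is.
  rw [← Set.image_nonempty (f := fun p : N.Policy => p.flowAssignment A),
    ← Set.image_nonempty (f := fun p : N.Policy => p.flowAssignment A)]
  exact iff_of_eq (congrArg Set.Nonempty (flowSpace1_eq_flowSpace2 A q.2))

end Network

/-! ### A single link separating the two policy spaces. -/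

namespace Network

/-- One link of capacity `1 / 2` from node `0` to the destination `1`, unit lifetimes. -/
noncomputable def oneLink : Network (Fin 2) where
  links := {(0, 1)}
  dest := 1
  maxLife := 1
  maxLife_pos := le_rfl
  capacity _ := 1 / 2
  capacity_nonneg _ := by norm_num

/-- One packet arrives at node `0` in every slot. -/
def unitArrival : oneLink.Arrival := fun i _ => if i = 0 then 1 else 0

noncomputable def unitArrivalLaw : oneLink.ArrivalLaw where
  law := Measure.dirac unitArrival
  isProb := inferInstance
  bounded := by
    refine ⟨1, ?_⟩
    rw [ae_dirac_eq, eventually_pure]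
    intro i l
    unfold unitArrival
    split_ifs <;> norm_num
  dest_zero := by
    rw [ae_dirac_eq, eventually_pure]
    intro l
    simp [unitArrival, oneLink]

theorem rate_unitArrivalLaw : unitArrivalLaw.rate = unitArrival := by
  funext i l
  simp [ArrivalLaw.rate, unitArrivalLaw]

instance : Unique oneLink.links :=
  inferInstanceAs (Unique ↥({((0 : Fin 2), (1 : Fin 2))} : Finset (Fin 2 × Fin 2)))

instance : Unique (Lifetime oneLink.maxLife) where
  default := ⟨1, by simp [oneLink]⟩
  uniq l := Subtype.ext <| by
    have := Finset.mem_Icc.1 l.2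
    have h1 : oneLink.maxLife = 1 := rfl
    change (l : ℕ) = 1
    omega

theorem oneLink_link (e : ↥oneLink.links) : e.1 = (0, 1) := Finset.mem_singleton.1 e.2

theorem atLife_one (f : Lifetime oneLink.maxLife → ℝ) : atLife f 1 = f default :=
  atLife_coe f default

theorem outflow_oneLink_zero (f : oneLink.Flow) :
    oneLink.outflow f 0 1 = f default default := by
  simp [outflow, oneLink_link, atLife_one]

theorem outflow_oneLink_one (f : oneLink.Flow) (l : ℕ) : oneLink.outflow f 1 l = 0 := by
  simp [outflow, oneLink_link]

theorem inflow_oneLink_one (f : oneLink.Flow) :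
    oneLink.inflow f 1 1 = f default default := by
  simp [inflow, oneLink_link, atLife_one]

theorem norm1_unitArrival : oneLink.norm1 unitArrival = 1 := by
  simp [norm1, unitArrival]

theorem isFeasible_half :
    oneLink.IsFeasible unitArrivalLaw.rate (1 / 2) (fun _ _ => 1 / 2) := by
  rw [rate_unitArrivalLaw]
  have hL : oneLink.maxLife = 1 := rfl
  refine ⟨fun _ _ => by norm_num, ?_, fun e => ?_, fun i l hl => ?_, fun e he => ?_⟩
  · have hd : oneLink.dest = 1 := rfl
    simp [inflowGe, hL, hd, inflow_oneLink_one, norm1_unitArrival]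
  · rw [Fintype.sum_unique]
    exact le_rfl
  · obtain rfl : l = 1 := by rw [Finset.mem_Icc] at hl; omega
    have hi : i = 0 ∨ i = 1 := by omega
    rcases hi with rfl | rfl
    · simp [inflowGe, outflowGe, hL, outflow_oneLink_zero, atLife_one, unitArrival]
      norm_num
    · simp [inflowGe, outflowGe, hL, outflow_oneLink_one, atLife_one, unitArrival]
  · rw [oneLink_link] at he
    exact absurd he (by simp [oneLink])

/-- Nothing in slot `0`, a full packet in slot `1`, half a packet afterwards. -/
noncomputable def burstFlow (t : ℕ) : oneLink.Flow :=
  fun _ _ => if t = 0 then 0 else if t = 1 then 1 else 1 / 2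

theorem tendsAvg_burstFlow (e : ↥oneLink.links) (l : Lifetime oneLink.maxLife) :
    TendsAvg (fun t => burstFlow t e l) (1 / 2) := by
  refine TendsAvg.of_eventually_const (n := 2) fun t ht => ?_
  rw [burstFlow, if_neg (by omega), if_neg (by omega)]

/-- With unit lifetimes unsent packets expire, so the backlog at node `0` is one in every slot after
the first. It covers the burst, and the average rate is still `1 / 2`. -/
theorem burst_isAdmissible1 :
    (oneLink.schedule burstFlow).IsAdmissible1 unitArrivalLaw (1 / 2) := by
  have hreg := isRegular_schedule unitArrivalLaw (x := burstFlow)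
    (fun t e l => by unfold burstFlow; split_ifs <;> norm_num) tendsAvg_burstFlow
  have hfa := flowAssignment_schedule unitArrivalLaw tendsAvg_burstFlow
  have hL : oneLink.maxLife = 1 := rfl
  refine ⟨hreg, (hreg.isReliable_iff _).2 (by rw [hfa]; exact isFeasible_half.reliable), fun e => ?_,
    fun t => ?_⟩
  · rw [(hreg.tendsAvg_total e).timeAvg_eq, hfa]
    exact isFeasible_half.capacity e
  · have harr : ∀ᵐ ω ∂(oneLink.schedule burstFlow).prob unitArrivalLaw,
        ∀ s, ω.1 s = unitArrival := by
      refine ae_all_iff.2 fun s => ?_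
      refine (measurePreserving_arrival _ unitArrivalLaw s).quasiMeasurePreserving.ae
        (p := fun a => a = unitArrival) ?_
      rw [unitArrivalLaw, ae_dirac_eq, eventually_pure]
    filter_upwards [harr] with ω hω i l hl
    obtain rfl : l = 1 := by rw [Finset.mem_Icc] at hl; omega
    rw [flow_schedule]
    have hi : i = 0 ∨ i = 1 := by omega
    rcases hi with rfl | rfl
    · rw [outflow_oneLink_zero, Policy.backlog]
      cases t with
      | zero => simp [burstFlow, queue]
      | succ t =>
        have h2 : 1 + 1 ∉ Finset.Icc 1 oneLink.maxLife := by simp [hL]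
        rw [queue, if_neg (by simp [oneLink]), queue_of_notMem _ _ _ _ h2,
          outflow_of_notMem _ h2, inflow_of_notMem _ h2, hω, atLife_one]
        simp only [burstFlow, unitArrival]
        split_ifs <;> norm_num at *
    · rw [outflow_oneLink_one]
      exact (queue_dest _ _ _ _).ge

theorem burst_not_isAdmissible2 :
    ¬ (oneLink.schedule burstFlow).IsAdmissible2 unitArrivalLaw (1 / 2) := by
  intro h
  obtain ⟨ω, hω⟩ := (h.capacity 1).exists
  have := hω default
  have hc : oneLink.capacity default = 1 / 2 := rfl
  rw [flow_schedule, Fintype.sum_unique, hc] at this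
  norm_num [burstFlow] at this

/-- Queues start empty, so sending in slot `0` violates availability. -/
theorem half_not_isAdmissible1 :
    ¬ (oneLink.schedule fun _ _ _ => 1 / 2).IsAdmissible1 unitArrivalLaw (1 / 2) := by
  intro h
  obtain ⟨ω, hω⟩ := (h.availability 0).exists
  have := hω 0 1 (by simp [oneLink])
  rw [flow_schedule, outflow_oneLink_zero] at this
  norm_num [Policy.backlog, queue] at this

end Network

theorem proposition3 :
    (∀ (V : Type*) [Fintype V] [DecidableEq V] (N : Network V),
      N.capacityRegion1 = N.capacityRegion2 ∧
      ∀ (lam : N.Arrival) (γ : ℝ), (lam, γ) ∈ N.capacityRegion1 →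
        ∀ A : N.ArrivalLaw, A.rate = lam → N.flowSpace1 A γ = N.flowSpace2 A γ) ∧
    (∃ (n : ℕ) (N : Network (Fin n)) (A : N.ArrivalLaw) (γ : ℝ),
      0 < γ ∧ γ ≤ 1 ∧ (A.rate, γ) ∈ N.capacityRegion1 ∧
      ¬ N.policySpace1 A γ ⊆ N.policySpace2 A γ ∧
      ¬ N.policySpace2 A γ ⊆ N.policySpace1 A γ) := by
  refine ⟨fun V _ _ N => ⟨N.capacityRegion1_eq_capacityRegion2, fun _ γ _ A _ =>
    Network.flowSpace1_eq_flowSpace2 A γ⟩, 2, Network.oneLink, Network.unitArrivalLaw, 1 / 2,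
    by norm_num, by norm_num, ⟨Network.unitArrivalLaw, rfl, _, Network.burst_isAdmissible1⟩,
    fun h => ?_, fun h => ?_⟩
  · exact Network.burst_not_isAdmissible2 (h Network.burst_isAdmissible1)
  · exact Network.half_not_isAdmissible1 (h Network.isFeasible_half.isAdmissible2)
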